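/- **Theorem 1.3.** Let $d \ge 2$, let $\mathbb S^{d-1}$ be the unit sphere of $\mathbb R^d$, and let $p>0$ be a real number that is not an even integer. For a Borel probability measure $\mu$ on $\mathbb S^{d-1}$, let $$I_f(\mu) = \int_{\mathbb S^{d-1}}\int_{\mathbb S^{d-1}} |\langle x,y\rangle|^p \, d\mu(x)\, d\mu(y)$$ be its $p$-frame energy, i.e. its energy with respect to $f(t)=|t|^p$. Let $\mu$ be a minimizer of $I_f$ among all Borel probability measures on $\mathbb S^{d-1}$. Then the support of $\mu$ has empty interior relative to $\mathbb S^{d-1}$: $$(\operatorname{supp}\mu)^\circ = \emptyset .$$ -/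

import Mathlib

open MeasureTheory

/-- The unit sphere `S^{d-1}` of `ℝ^d`, as a subtype, so that it carries the subspace topology and
the corresponding Borel σ-algebra. -/
abbrev UnitSphere (d : ℕ) : Type :=
  Metric.sphere (0 : EuclideanSpace ℝ (Fin d)) 1

/-- The `p`-frame energy `I_f(μ) = ∫∫ |⟨x, y⟩|^p dμ(x) dμ(y)` of a Borel probability measure `μ`
on `S^{d-1}`. For `p > 0` the integrand is continuous with values in `[0, 1]`, so
that the Bochner integrals have their intended values. -/
noncomputable def pFrameEnergy {d : ℕ} (p : ℝ) (μ : ProbabilityMeasure (UnitSphere d)) : ℝ :=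
  ∫ y : UnitSphere d, ∫ x : UnitSphere d,
    |inner ℝ (x : EuclideanSpace ℝ (Fin d)) (y : EuclideanSpace ℝ (Fin d))| ^ p
      ∂(μ : Measure (UnitSphere d)) ∂(μ : Measure (UnitSphere d))

/-- `μ` minimizes the `p`-frame energy among all Borel probability measures on `S^{d-1}`. -/
def IsPFrameMinimizer {d : ℕ} (p : ℝ) (μ : ProbabilityMeasure (UnitSphere d)) : Prop :=
  ∀ ν : ProbabilityMeasure (UnitSphere d), pFrameEnergy p μ ≤ pFrameEnergy p ν

open Filter Topology Asymptotics

/-! Let `C > 0` be the minimal energy. The second variation at a minimizer makes the kernel minus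
`C` positive semidefinite on the support (`kernelEnergy_mul_sq_sum_le`). If the support had an
interior point, a short arc of a great circle through it would lie in the support. Along this arc,
after rescaling the weights, `(1 + s t) ^ p` dominates `C (1 + s ^ 2) ^ (p / 2) (1 + t ^ 2) ^ (p /
2)` (`DominatesRankOne`).

Testing with `k`-th finite differences and letting the step shrink compares Taylor coefficients:
`choose p k ≥ 0` for all `k`, and `C * choose (p / 2) l ^ 2 ≤ choose p (2 * l)`. The first fails for
non-integer `p`, the second for odd `p`. -/

/-! ### Signs of generalized binomial coefficients. -/

/-- The recurrence `(n + 1) * choose r (n + 1) = choose r n * (r - n)`. -/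
theorem Real.succ_mul_choose_succ (r : ℝ) (n : ℕ) :
    ((n : ℝ) + 1) * Ring.choose r (n + 1) = Ring.choose r n * (r - n) := by
  have h := Ring.choose_smul_choose r (Nat.le_succ n)
  simpa using h

theorem Real.choose_pos (r : ℝ) (n : ℕ) (h : (n : ℝ) < r + 1) : 0 < Ring.choose r n := by
  induction n with
  | zero => simp
  | succ n ih =>
    push_cast at h
    have h1 := ih (by linarith)
    have h2 := Real.succ_mul_choose_succ r n
    have h3 : 0 < ((n : ℝ) + 1) * Ring.choose r (n + 1) := by
      rw [h2]; exact mul_pos h1 (by linarith)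
    exact pos_of_mul_pos_right h3 (by positivity)

/-- Among the factors `r, r - 1, ..., r - n` only the last is negative. -/
theorem Real.choose_succ_neg (r : ℝ) (n : ℕ) (h : (n : ℝ) < r + 1) (h' : r < n) :
    Ring.choose r (n + 1) < 0 := by
  have h2 := Real.succ_mul_choose_succ r n
  have h3 : ((n : ℝ) + 1) * Ring.choose r (n + 1) < 0 := by
    rw [h2]; exact mul_neg_of_pos_of_neg (Real.choose_pos r n h) (by linarith)
  by_contra! h4
  exact absurd h3 (not_lt.2 (by positivity))

/-! ### Finite differences and leading Taylor terms. -/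

/-- Coefficients of the `k`-th finite difference. -/
def differenceWeight (k i : ℕ) : ℝ := (-1) ^ (k - i) * (k.choose i : ℝ)

theorem sum_differenceWeight_mul_pow (k m : ℕ) :
    ∑ i ∈ Finset.range (k + 1), differenceWeight k i * (i : ℝ) ^ m =
      (fwdDiff 1)^[k] (fun r : ℝ ↦ r ^ m) 0 := by
  rw [fwdDiff_iter_eq_sum_shift]
  simp [differenceWeight]

theorem sum_differenceWeight_mul_pow_of_lt {k m : ℕ} (h : m < k) :
    ∑ i ∈ Finset.range (k + 1), differenceWeight k i * (i : ℝ) ^ m = 0 := by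
  rw [sum_differenceWeight_mul_pow, fwdDiff_iter_pow_eq_zero_of_lt h]; rfl

theorem sum_differenceWeight_mul_pow_self (k : ℕ) :
    ∑ i ∈ Finset.range (k + 1), differenceWeight k i * (i : ℝ) ^ k = k.factorial := by
  rw [sum_differenceWeight_mul_pow, fwdDiff_iter_eq_factorial]; simp

theorem isLittleO_one_add_rpow_sub_sum (p : ℝ) (l : ℕ) :
    (fun u : ℝ ↦ (1 + u) ^ p - ∑ m ∈ Finset.range (l + 1), Ring.choose p m * u ^ m)
      =o[𝓝 0] fun u ↦ u ^ l := by
  have h := (Real.one_add_rpow_hasFPowerSeriesAt_zero (a := p)).isBigO_sub_partialSum_pow (l + 1)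
  have h' : (fun u : ℝ ↦ ‖u‖ ^ (l + 1)) =o[𝓝 0] fun u ↦ u ^ l := by
    simp_rw [← norm_pow]
    exact (isLittleO_pow_pow (Nat.lt_succ_self l)).norm_left
  refine (h.trans_isLittleO h').congr_left fun u ↦ ?_
  simp [FormalMultilinearSeries.partialSum, binomialSeries, mul_comm]

/-- If the weights annihilate the powers of degree less than `l` of the nodes, then the weighted sum
of a function over the dilated nodes is governed by its Taylor coefficient of order `l`. -/
theorem tendsto_weighted_sum_div_pow {ι : Type*} (s : Finset ι) (w v : ι → ℝ) (f : ℝ → ℝ)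
    (a : ℕ → ℝ) (l : ℕ) (hw : ∀ m < l, ∑ i ∈ s, w i * v i ^ m = 0)
    (hf : (fun u ↦ f u - ∑ m ∈ Finset.range (l + 1), a m * u ^ m) =o[𝓝 0] fun u ↦ u ^ l) :
    Tendsto (fun h : ℝ ↦ (∑ i ∈ s, w i * f (h * v i)) / h ^ l) (𝓝[>] 0)
      (𝓝 (a l * ∑ i ∈ s, w i * v i ^ l)) := by
  set R : ℝ → ℝ := fun u ↦ f u - ∑ m ∈ Finset.range (l + 1), a m * u ^ m with hR
  have hRi (i : ι) : Tendsto (fun h : ℝ ↦ R (h * v i) / h ^ l) (𝓝[>] 0) (𝓝 0) := by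
    have h0 : Tendsto (fun h : ℝ ↦ h * v i) (𝓝[>] 0) (𝓝 0) := by
      have : Tendsto (fun h : ℝ ↦ h * v i) (𝓝 0) (𝓝 (0 * v i)) := tendsto_id.mul_const _
      rw [zero_mul] at this
      exact this.mono_left nhdsWithin_le_nhds
    have h1 := hf.comp_tendsto h0
    have h2 : ((fun u : ℝ ↦ u ^ l) ∘ fun h : ℝ ↦ h * v i) =O[𝓝[>] 0] fun h ↦ h ^ l := by
      refine IsBigO.of_bound (‖v i ^ l‖) (Eventually.of_forall fun h ↦ ?_)
      simp [mul_pow, mul_comm]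
    exact (h1.trans_isBigO h2).tendsto_div_nhds_zero
  have hsum : Tendsto (fun h : ℝ ↦ a l * ∑ i ∈ s, w i * v i ^ l + ∑ i ∈ s, w i * (R (h * v i) / h ^ l))
      (𝓝[>] 0) (𝓝 (a l * ∑ i ∈ s, w i * v i ^ l + ∑ i ∈ s, w i * 0)) :=
    tendsto_const_nhds.add (tendsto_finsetSum _ fun i _ ↦ (hRi i).const_mul _)
  simp only [mul_zero, Finset.sum_const_zero, add_zero] at hsum
  refine hsum.congr' ?_
  filter_upwards [self_mem_nhdsWithin] with h hh
  have hh : 0 < h := hh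
  have hpoly : ∑ i ∈ s, w i * ∑ m ∈ Finset.range (l + 1), a m * (h * v i) ^ m =
      h ^ l * (a l * ∑ i ∈ s, w i * v i ^ l) := by
    simp_rw [Finset.mul_sum]
    rw [Finset.sum_comm, Finset.sum_range_succ, Finset.sum_eq_zero, zero_add]
    · exact Finset.sum_congr rfl fun i _ ↦ by ring
    · intro m hm
      have := hw m (Finset.mem_range.1 hm)
      calc _ = a m * h ^ m * ∑ i ∈ s, w i * v i ^ m := by
            rw [Finset.mul_sum]; exact Finset.sum_congr rfl fun i _ ↦ by ring
        _ = 0 := by rw [this, mul_zero]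
  have hsplit : ∑ i ∈ s, w i * f (h * v i) =
      h ^ l * (a l * ∑ i ∈ s, w i * v i ^ l) + ∑ i ∈ s, w i * R (h * v i) := by
    rw [← hpoly, ← Finset.sum_add_distrib]
    exact Finset.sum_congr rfl fun i _ ↦ by simp only [hR]; ring
  rw [hsplit, add_div, mul_div_cancel_left₀ _ (by positivity), Finset.sum_div]
  simp_rw [mul_div_assoc]

/-- With nodes `i * j` and product weights, each moment is the square of a one-variable moment,
whence the factor `k! ^ 2`. -/
theorem tendsto_double_difference_div_pow (p : ℝ) (k : ℕ) :
    Tendsto (fun u : ℝ ↦ (∑ i ∈ Finset.range (k + 1), ∑ j ∈ Finset.range (k + 1),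
      differenceWeight k i * differenceWeight k j * (1 + u * (i * j)) ^ p) / u ^ k) (𝓝[>] 0)
      (𝓝 (Ring.choose p k * (k.factorial : ℝ) ^ 2)) := by
  have hpow (m : ℕ) : ∑ x ∈ Finset.range (k + 1) ×ˢ Finset.range (k + 1),
      differenceWeight k x.1 * differenceWeight k x.2 * ((x.1 : ℝ) * x.2) ^ m =
      (∑ i ∈ Finset.range (k + 1), differenceWeight k i * (i : ℝ) ^ m) ^ 2 := by
    rw [sq, Finset.sum_mul_sum, ← Finset.sum_product']
    exact Finset.sum_congr rfl fun x _ ↦ by ring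
  have h := tendsto_weighted_sum_div_pow (Finset.range (k + 1) ×ˢ Finset.range (k + 1))
    (fun x ↦ differenceWeight k x.1 * differenceWeight k x.2) (fun x ↦ (x.1 : ℝ) * x.2)
    (fun u ↦ (1 + u) ^ p) (fun m ↦ Ring.choose p m) k
    (fun m hm ↦ by rw [hpow, sum_differenceWeight_mul_pow_of_lt hm]; simp)
    (isLittleO_one_add_rpow_sub_sum p k)
  simp only [hpow, sum_differenceWeight_mul_pow_self] at h
  simpa only [Finset.sum_product] using h

/-- The nodes are squares, so a difference of order `2 * l` annihilates only their powers below `l`.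
-/
theorem tendsto_difference_div_pow (q : ℝ) (l : ℕ) :
    Tendsto (fun u : ℝ ↦ (∑ i ∈ Finset.range (2 * l + 1),
      differenceWeight (2 * l) i * (1 + u * (i : ℝ) ^ 2) ^ q) / u ^ l) (𝓝[>] 0)
      (𝓝 (Ring.choose q l * ((2 * l).factorial : ℝ))) := by
  have h := tendsto_weighted_sum_div_pow (Finset.range (2 * l + 1))
    (differenceWeight (2 * l)) (fun i ↦ (i : ℝ) ^ 2)
    (fun u ↦ (1 + u) ^ q) (fun m ↦ Ring.choose q m) l
    (fun m hm ↦ by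
      simp_rw [← pow_mul]
      exact sum_differenceWeight_mul_pow_of_lt (by omega))
    (isLittleO_one_add_rpow_sub_sum q l)
  simpa only [← pow_mul, sum_differenceWeight_mul_pow_self] using h

/-! ### The one-dimensional positivity condition and its contradiction. -/

/-- The kernel `(1 + s t) ^ p` dominates, for small `s` and `t`, the rank one kernel
`C (1 + s ^ 2) ^ (p / 2) (1 + t ^ 2) ^ (p / 2)` in the sense of quadratic forms. -/
def DominatesRankOne (p C : ℝ) : Prop :=
  ∃ δ > 0, ∀ (n : ℕ) (w s : ℕ → ℝ), (∀ i ∈ Finset.range n, |s i| < δ) →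
    C * (∑ i ∈ Finset.range n, w i * (1 + s i ^ 2) ^ (p / 2)) ^ 2 ≤
      ∑ i ∈ Finset.range n, ∑ j ∈ Finset.range n, w i * w j * (1 + s i * s j) ^ p

theorem DominatesRankOne.eventually {p C : ℝ} (H : DominatesRankOne p C) (k : ℕ) :
    ∀ᶠ u : ℝ in 𝓝[>] 0, C * (∑ i ∈ Finset.range (k + 1),
      differenceWeight k i * (1 + u * (i : ℝ) ^ 2) ^ (p / 2)) ^ 2 ≤
      ∑ i ∈ Finset.range (k + 1), ∑ j ∈ Finset.range (k + 1),
        differenceWeight k i * differenceWeight k j * (1 + u * (i * j)) ^ p := by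
  obtain ⟨δ, hδ, H⟩ := H
  have h0 : Tendsto (fun u : ℝ ↦ √u * k) (𝓝[>] 0) (𝓝 0) := by
    have : Tendsto (fun u : ℝ ↦ √u * k) (𝓝 0) (𝓝 (√0 * k)) :=
      (Real.continuous_sqrt.tendsto 0).mul_const _
    rw [Real.sqrt_zero, zero_mul] at this
    exact this.mono_left nhdsWithin_le_nhds
  filter_upwards [self_mem_nhdsWithin, h0.eventually_lt_const hδ] with u hu hk
  have hu : 0 < u := hu
  -- With step `√u`, both products and squares of nodes are linear in `u`.
  have h := H (k + 1) (differenceWeight k) (fun i ↦ √u * i) fun i hi ↦ by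
    rw [abs_of_nonneg (by positivity)]
    refine lt_of_le_of_lt ?_ hk
    have : (i : ℝ) ≤ k := by exact_mod_cast Nat.lt_succ_iff.1 (Finset.mem_range.1 hi)
    gcongr
  have h2 (i j : ℕ) : √u * i * (√u * j) = u * (i * j) := by
    rw [mul_mul_mul_comm, Real.mul_self_sqrt hu.le]
  simpa only [mul_pow, Real.sq_sqrt hu.le, h2] using h

theorem DominatesRankOne.choose_nonneg {p C : ℝ} (hC : 0 ≤ C) (H : DominatesRankOne p C) (k : ℕ) :
    0 ≤ Ring.choose p k := by
  have h : 0 ≤ Ring.choose p k * (k.factorial : ℝ) ^ 2 := by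
    refine ge_of_tendsto (tendsto_double_difference_div_pow p k) ?_
    filter_upwards [self_mem_nhdsWithin, H.eventually k] with u hu h
    have hu : 0 < u := hu
    exact div_nonneg (le_trans (by positivity) h) (by positivity)
  exact nonneg_of_mul_nonneg_left h (by positivity)

theorem DominatesRankOne.mul_choose_sq_le {p C : ℝ} (H : DominatesRankOne p C) (l : ℕ) :
    C * Ring.choose (p / 2) l ^ 2 ≤ Ring.choose p (2 * l) := by
  have h : C * (Ring.choose (p / 2) l * ((2 * l).factorial : ℝ)) ^ 2 ≤
      Ring.choose p (2 * l) * ((2 * l).factorial : ℝ) ^ 2 := by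
    refine le_of_tendsto_of_tendsto (((tendsto_difference_div_pow (p / 2) l).pow 2).const_mul C)
      (tendsto_double_difference_div_pow p (2 * l)) ?_
    filter_upwards [self_mem_nhdsWithin, H.eventually (2 * l)] with u hu h
    have hu : 0 < u := hu
    rw [div_pow, ← pow_mul, mul_comm l 2, ← mul_div_assoc]
    gcongr
  rw [mul_pow, ← mul_assoc] at h
  exact le_of_mul_le_mul_right h (by positivity)

/-- Domination of a rank one kernel with a positive constant forces `p` to be an even integer. -/
theorem DominatesRankOne.false_of_not_even {p C : ℝ} (hp : 0 < p)
    (hp_even : ∀ k : ℕ, p ≠ 2 * (k : ℝ)) (hC : 0 < C) (H : DominatesRankOne p C) : False := by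
  by_cases hint : ∃ n : ℕ, p = n
  · obtain ⟨n, rfl⟩ := hint
    obtain ⟨l, rfl | rfl⟩ := Nat.even_or_odd' n
    · exact hp_even l (by push_cast; ring)
    -- Here `2 * (l + 1) = p + 1`, so the right side vanishes, while `l + 1 < p / 2 + 1` keeps the
    -- left side positive.
    · have h := H.mul_choose_sq_le (l + 1)
      rw [Ring.choose_natCast, Nat.choose_eq_zero_of_lt (by omega)] at h
      have : 0 < Ring.choose (((2 * l + 1 : ℕ) : ℝ) / 2) (l + 1) :=
        Real.choose_pos _ _ (by push_cast; linarith)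
      have : 0 < C * Ring.choose (((2 * l + 1 : ℕ) : ℝ) / 2) (l + 1) ^ 2 := by positivity
      rw [Nat.cast_zero] at h
      linarith
  · push Not at hint
    -- This is the first negative coefficient: its only negative factor is `p - (⌊p⌋₊ + 1)`.
    have h := H.choose_nonneg hC.le (⌊p⌋₊ + 1 + 1)
    have h1 : (⌊p⌋₊ : ℝ) < p := lt_of_le_of_ne (Nat.floor_le hp.le) (hint _).symm
    have := Real.choose_succ_neg p (⌊p⌋₊ + 1) (by push_cast; linarith)
      (by push_cast; exact Nat.lt_floor_add_one p)
    linarith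

theorem eq_zero_and_nonneg_of_forall_small {α β δ : ℝ} (hδ : 0 < δ)
    (h : ∀ t, |t| < δ → 0 ≤ t * α + t ^ 2 * β) : α = 0 ∧ 0 ≤ β := by
  have hα : α = 0 := by
    have h0 : Tendsto (fun t : ℝ ↦ α + t * β) (𝓝 0) (𝓝 (α + 0 * β)) :=
      (tendsto_id.mul_const β).const_add α
    rw [zero_mul, add_zero] at h0
    have hs : ∀ᶠ t : ℝ in 𝓝 0, |t| < δ := by
      filter_upwards [Metric.ball_mem_nhds (0 : ℝ) hδ] with t ht
      simpa using ht
    refine le_antisymm ?_ ?_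
    · refine le_of_tendsto (h0.mono_left (nhdsWithin_le_nhds (s := Set.Iio 0))) ?_
      filter_upwards [nhdsWithin_le_nhds hs, self_mem_nhdsWithin] with t ht hn
      have hn : t < 0 := hn
      have := h t ht
      by_contra! hc
      nlinarith [mul_neg_of_neg_of_pos hn hc]
    · refine ge_of_tendsto (h0.mono_left (nhdsWithin_le_nhds (s := Set.Ioi 0))) ?_
      filter_upwards [nhdsWithin_le_nhds hs, self_mem_nhdsWithin] with t ht hn
      have hn : 0 < t := hn
      have := h t ht
      by_contra! hc
      nlinarith [mul_neg_of_pos_of_neg hn hc]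
  refine ⟨hα, ?_⟩
  have h1 := h (δ / 2) (by rw [abs_of_pos (by positivity)]; linarith)
  rw [hα, mul_zero, zero_add] at h1
  exact nonneg_of_mul_nonneg_right h1 (by positivity)

/-! ### Second variation of the energy. -/

section Energy

variable {X : Type*} [MeasurableSpace X]

/-- The energy of a measure with respect to a kernel, as an iterated integral. -/
noncomputable def kernelEnergy (K : X → X → ℝ) (μ : Measure X) : ℝ :=
  ∫ y, ∫ x, K x y ∂μ ∂μ

variable {K : X → X → ℝ} {M : ℝ} {μ : Measure X} [IsProbabilityMeasure μ]

theorem integrable_kernel_mul (hK : Measurable (Function.uncurry K)) (hM : ∀ x y, |K x y| ≤ M)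
    {φ : X × X → ℝ} (hφ : Measurable φ) {B : ℝ} (hB : ∀ z, |φ z| ≤ B) :
    Integrable (fun z : X × X ↦ K z.1 z.2 * φ z) (μ.prod μ) := by
  refine Integrable.of_bound (C := M * B) (hK.mul hφ).aestronglyMeasurable
    (Eventually.of_forall fun z ↦ ?_)
  rw [Real.norm_eq_abs, abs_mul]
  exact mul_le_mul (hM _ _) (hB _) (abs_nonneg _) ((abs_nonneg _).trans (hM z.1 z.2))

theorem kernelEnergy_withDensity (hK : Measurable (Function.uncurry K))
    (hM : ∀ x y, |K x y| ≤ M) {g : X → ℝ} (hg : Measurable g) (hg0 : ∀ x, 0 ≤ g x) {B : ℝ}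
    (hB : ∀ x, |g x| ≤ B) :
    kernelEnergy K (μ.withDensity fun x ↦ ENNReal.ofReal (g x)) =
      ∫ z : X × X, K z.1 z.2 * (g z.1 * g z.2) ∂(μ.prod μ) := by
  have hlt : ∀ᵐ x ∂μ, ENNReal.ofReal (g x) < ⊤ := by simp
  have hm : Measurable fun x ↦ ENNReal.ofReal (g x) := hg.ennreal_ofReal
  unfold kernelEnergy
  rw [integral_withDensity_eq_integral_toReal_smul hm hlt, integral_prod_symm]
  · refine integral_congr_ae (Eventually.of_forall fun y ↦ ?_)
    simp only
    rw [integral_withDensity_eq_integral_toReal_smul hm hlt, smul_eq_mul, ← integral_const_mul]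
    refine integral_congr_ae (Eventually.of_forall fun x ↦ ?_)
    simp only [ENNReal.toReal_ofReal (hg0 _), smul_eq_mul]
    ring
  · refine integrable_kernel_mul hK hM (by fun_prop) (B := B * B) fun z ↦ ?_
    rw [abs_mul]
    exact mul_le_mul (hB _) (hB _) (abs_nonneg _) ((abs_nonneg _).trans (hB z.1))

/-- The second variation of the energy at a minimizer. -/
theorem sq_integral_mul_kernelEnergy_le (hK : Measurable (Function.uncurry K))
    (hM : ∀ x y, |K x y| ≤ M)
    (hmin : ∀ ν : Measure X, IsProbabilityMeasure ν → kernelEnergy K μ ≤ kernelEnergy K ν)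
    {g : X → ℝ} (hg : Measurable g) {B : ℝ} (hB : ∀ x, |g x| ≤ B) :
    (∫ x, g x ∂μ) ^ 2 * kernelEnergy K μ ≤
      ∫ z : X × X, K z.1 z.2 * (g z.1 * g z.2) ∂(μ.prod μ) := by
  have hgi : Integrable g μ := Integrable.of_bound hg.aestronglyMeasurable (C := B)
    (Eventually.of_forall hB)
  set a := ∫ x, g x ∂μ with ha
  set Q := ∫ z : X × X, K z.1 z.2 * (g z.1 * g z.2) ∂(μ.prod μ)
  set L := ∫ z : X × X, K z.1 z.2 * (g z.1 + g z.2) ∂(μ.prod μ)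
  set C := kernelEnergy K μ with hC
  have i1 : Integrable (fun z : X × X ↦ K z.1 z.2) (μ.prod μ) := by
    simpa using integrable_kernel_mul (μ := μ) hK hM (measurable_const (a := (1 : ℝ))) (B := 1)
      (by simp)
  have i2 : Integrable (fun z : X × X ↦ K z.1 z.2 * (g z.1 + g z.2)) (μ.prod μ) :=
    integrable_kernel_mul hK hM (by fun_prop) (B := B + B) fun z ↦
      (abs_add_le _ _).trans (add_le_add (hB _) (hB _))
  have i3 : Integrable (fun z : X × X ↦ K z.1 z.2 * (g z.1 * g z.2)) (μ.prod μ) :=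
    integrable_kernel_mul hK hM (by fun_prop) (B := B * B) fun z ↦ by
      rw [abs_mul]
      exact mul_le_mul (hB _) (hB _) (abs_nonneg _) ((abs_nonneg _).trans (hB z.1))
  have hCprod : ∫ z : X × X, K z.1 z.2 ∂(μ.prod μ) = C := integral_prod_symm _ i1
  obtain ⟨x₀⟩ : Nonempty X := nonempty_of_isProbabilityMeasure μ
  have hB0 : 0 ≤ B := (abs_nonneg _).trans (hB x₀)
  have hδ : 0 < 1 / (B + |a| + 1) := by positivity
  -- The competitor has density `1 + t * (g - a)`, of total mass one; the bound on `t` keeps it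
  -- nonnegative for both signs of `t`. Its energy is quadratic in `t`.
  have key (t : ℝ) (ht : |t| < 1 / (B + |a| + 1)) :
      0 ≤ t * (L - 2 * a * C) + t ^ 2 * (a ^ 2 * C - a * L + Q) := by
    have hsmall (x : X) : |t * (g x - a)| ≤ 1 := by
      rw [abs_mul]
      rw [lt_div_iff₀ (by positivity)] at ht
      have h1 : |g x - a| ≤ B + |a| + 1 := by
        have := abs_sub (g x) a
        have := hB x
        linarith
      exact (mul_le_mul_of_nonneg_left h1 (abs_nonneg t)).trans ht.le
    set φ : X → ℝ := fun x ↦ 1 + t * (g x - a) with hφ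
    have hφm : Measurable φ := by fun_prop
    have hφ0 (x : X) : 0 ≤ φ x := by
      have := (abs_le.1 (hsmall x)).1
      simp only [hφ]; linarith
    have hφB (x : X) : |φ x| ≤ 2 := by
      have := abs_le.1 (hsmall x)
      rw [abs_le]; constructor <;> simp only [hφ] <;> linarith [this.1, this.2]
    have hφi : Integrable φ μ := Integrable.of_bound hφm.aestronglyMeasurable (C := 2)
      (Eventually.of_forall hφB)
    have hφ1 : ∫ x, φ x ∂μ = 1 := by
      simp only [hφ]
      have hi : Integrable (fun x ↦ t * (g x - a)) μ := (hgi.sub (integrable_const a)).const_mul t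
      rw [integral_add (integrable_const _) hi,
        integral_const_mul, integral_sub hgi (integrable_const _)]
      simp [ha]
    have hprob : IsProbabilityMeasure (μ.withDensity fun x ↦ ENNReal.ofReal (φ x)) := by
      constructor
      rw [withDensity_apply _ MeasurableSet.univ, Measure.restrict_univ,
        ← ofReal_integral_eq_lintegral_ofReal hφi (Eventually.of_forall hφ0), hφ1,
        ENNReal.ofReal_one]
    have h := hmin _ hprob
    rw [kernelEnergy_withDensity hK hM hφm hφ0 hφB] at h
    have hexp : ∫ z : X × X, K z.1 z.2 * (φ z.1 * φ z.2) ∂(μ.prod μ) =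
        (1 - t * a) ^ 2 * C + (1 - t * a) * t * L + t ^ 2 * Q := by
      have j12 : Integrable (fun z : X × X ↦ (1 - t * a) ^ 2 * K z.1 z.2 +
          (1 - t * a) * t * (K z.1 z.2 * (g z.1 + g z.2))) (μ.prod μ) :=
        (i1.const_mul _).add (i2.const_mul _)
      have hpt (z : X × X) : K z.1 z.2 * (φ z.1 * φ z.2) = (1 - t * a) ^ 2 * K z.1 z.2 +
          (1 - t * a) * t * (K z.1 z.2 * (g z.1 + g z.2)) +
          t ^ 2 * (K z.1 z.2 * (g z.1 * g z.2)) := by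
        simp only [hφ]; ring
      simp_rw [hpt]
      rw [integral_add j12 (i3.const_mul _), integral_add (i1.const_mul _) (i2.const_mul _),
        integral_const_mul, integral_const_mul, integral_const_mul, hCprod]
    rw [hexp] at h
    linarith
  obtain ⟨h1, h2⟩ := eq_zero_and_nonneg_of_forall_small hδ key
  -- Stationarity turns the second-order coefficient into `Q - a ^ 2 * C`.
  have h3 : L = 2 * a * C := by linarith
  rw [h3] at h2
  linarith

end Energy

/-- At a minimizer of the energy, the kernel minus the minimal energy is positive semidefinite
on the support. -/
theorem kernelEnergy_mul_sq_sum_le {X : Type*} [PseudoMetricSpace X] [MeasurableSpace X]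
    [BorelSpace X] [SecondCountableTopology X] {K : X → X → ℝ} {M : ℝ} {μ : Measure X}
    [IsProbabilityMeasure μ] (hK : Continuous (Function.uncurry K)) (hM : ∀ x y, |K x y| ≤ M)
    (hmin : ∀ ν : Measure X, IsProbabilityMeasure ν → kernelEnergy K μ ≤ kernelEnergy K ν)
    {ι : Type*} (s : Finset ι) (w : ι → ℝ) (x : ι → X) (hx : ∀ i ∈ s, x i ∈ μ.support) :
    kernelEnergy K μ * (∑ i ∈ s, w i) ^ 2 ≤
      ∑ i ∈ s, ∑ j ∈ s, w i * w j * K (x i) (x j) := by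
  suffices h : ∀ ε > 0, kernelEnergy K μ * (∑ i ∈ s, w i) ^ 2 ≤
      ∑ i ∈ s, ∑ j ∈ s, w i * w j * K (x i) (x j) + ε * ∑ i ∈ s, ∑ j ∈ s, |w i| * |w j| by
    have ht : Tendsto (fun ε : ℝ ↦ ∑ i ∈ s, ∑ j ∈ s, w i * w j * K (x i) (x j) +
        ε * ∑ i ∈ s, ∑ j ∈ s, |w i| * |w j|) (𝓝[>] 0)
        (𝓝 (∑ i ∈ s, ∑ j ∈ s, w i * w j * K (x i) (x j) +
          0 * ∑ i ∈ s, ∑ j ∈ s, |w i| * |w j|)) :=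
      ((tendsto_id.mul_const _).const_add _).mono_left nhdsWithin_le_nhds
    rw [zero_mul, add_zero] at ht
    refine ge_of_tendsto ht ?_
    filter_upwards [self_mem_nhdsWithin] with ε hε using h ε hε
  intro ε hε
  obtain ⟨r, hr, hr0⟩ : ∃ r : ℝ, (∀ i ∈ s, ∀ j ∈ s, ∀ y ∈ Metric.ball (x i) r,
      ∀ z ∈ Metric.ball (x j) r, ‖K y z - K (x i) (x j)‖ ≤ ε) ∧ 0 < r := by
    have h : ∀ᶠ r : ℝ in 𝓝[>] 0, ∀ i ∈ s, ∀ j ∈ s, ∀ y ∈ Metric.ball (x i) r,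
        ∀ z ∈ Metric.ball (x j) r, ‖K y z - K (x i) (x j)‖ ≤ ε := by
      refine (Finset.eventually_all s).2 fun i _ ↦ (Finset.eventually_all s).2 fun j _ ↦ ?_
      obtain ⟨r, hr, h⟩ := Metric.continuousAt_iff.1 (hK.continuousAt (x := (x i, x j))) ε hε
      filter_upwards [Ioo_mem_nhdsGT hr] with r' hr' y hy z hz
      refine (h (x := (y, z)) ?_).le
      rw [Prod.dist_eq]
      exact max_lt (lt_trans hy hr'.2) (lt_trans hz hr'.2)
    exact (h.and self_mem_nhdsWithin).exists
  set A : ι → Set X := fun i ↦ Metric.ball (x i) r with hA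
  have hAm (i : ι) : MeasurableSet (A i) := Metric.isOpen_ball.measurableSet
  have hpos (i : ι) (hi : i ∈ s) : 0 < μ.real (A i) :=
    ENNReal.toReal_pos
      ((Measure.mem_support_iff_forall (x i)).1 (hx i hi) _ (Metric.ball_mem_nhds _ hr0)).ne'
      (measure_ne_top _ _)
  -- Point masses `w i` at `x i` are smeared over small balls, which have positive measure because
  -- the centres lie in the support.
  set c : ι → ℝ := fun i ↦ w i / μ.real (A i) with hc
  set g : X → ℝ := fun y ↦ ∑ i ∈ s, (A i).indicator (fun _ ↦ c i) y with hg
  have hgm : Measurable g :=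
    Finset.measurable_sum _ fun i _ ↦ measurable_const.indicator (hAm i)
  have hgB (y : X) : |g y| ≤ ∑ i ∈ s, |c i| :=
    (Finset.abs_sum_le_sum_abs _ _).trans (Finset.sum_le_sum fun i _ ↦ by
      simpa only [Real.norm_eq_abs] using norm_indicator_le_norm_self (fun _ : X ↦ c i) y)
  have hgint : ∫ y, g y ∂μ = ∑ i ∈ s, w i := by
    rw [integral_finsetSum _ fun i _ ↦ (integrable_const _).indicator (hAm i)]
    refine Finset.sum_congr rfl fun i hi ↦ ?_
    rw [integral_indicator_const _ (hAm i), smul_eq_mul, hc]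
    exact mul_div_cancel₀ _ (hpos i hi).ne'
  have hKi : Integrable (fun z : X × X ↦ K z.1 z.2) (μ.prod μ) := by
    simpa using integrable_kernel_mul (μ := μ) hK.measurable hM
      (measurable_const (a := (1 : ℝ))) (B := 1) (by simp)
  have hAA (i j : ι) : MeasurableSet (A i ×ˢ A j) := (hAm i).prod (hAm j)
  have hpt (z : X × X) : K z.1 z.2 * (g z.1 * g z.2) = ∑ i ∈ s, ∑ j ∈ s,
      c i * c j * (A i ×ˢ A j).indicator (fun z ↦ K z.1 z.2) z := by
    simp only [hg]
    rw [Finset.sum_mul_sum, Finset.mul_sum]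
    refine Finset.sum_congr rfl fun i _ ↦ ?_
    rw [Finset.mul_sum]
    refine Finset.sum_congr rfl fun j _ ↦ ?_
    by_cases h1 : z.1 ∈ A i <;> by_cases h2 : z.2 ∈ A j <;>
      simp [Set.indicator, Set.mem_prod, h1, h2, mul_comm]
  have hquad : ∫ z : X × X, K z.1 z.2 * (g z.1 * g z.2) ∂(μ.prod μ) = ∑ i ∈ s, ∑ j ∈ s,
      c i * c j * ∫ z in A i ×ˢ A j, K z.1 z.2 ∂(μ.prod μ) := by
    have hi (i j : ι) : Integrable
        (fun z ↦ c i * c j * (A i ×ˢ A j).indicator (fun z ↦ K z.1 z.2) z) (μ.prod μ) :=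
      (hKi.indicator (hAA i j)).const_mul _
    simp_rw [hpt]
    rw [integral_finsetSum _ fun i _ ↦ integrable_finsetSum _ fun j _ ↦ hi i j]
    refine Finset.sum_congr rfl fun i _ ↦ ?_
    rw [integral_finsetSum _ fun j _ ↦ hi i j]
    refine Finset.sum_congr rfl fun j _ ↦ ?_
    rw [integral_const_mul, integral_indicator (hAA i j)]
  have hest (i : ι) (hi : i ∈ s) (j : ι) (hj : j ∈ s) :
      c i * c j * ∫ z in A i ×ˢ A j, K z.1 z.2 ∂(μ.prod μ) ≤
        w i * w j * K (x i) (x j) + ε * (|w i| * |w j|) := by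
    have hm : (μ.prod μ).real (A i ×ˢ A j) = μ.real (A i) * μ.real (A j) := measureReal_prod_prod _ _
    have h1 := norm_setIntegral_le_of_norm_le_const (μ := μ.prod μ) (s := A i ×ˢ A j)
      (f := fun z ↦ K z.1 z.2 - K (x i) (x j)) (C := ε) (measure_lt_top _ _)
      (fun z hz ↦ hr i hi j hj _ hz.1 _ hz.2)
    rw [integral_sub hKi.integrableOn (integrable_const _), setIntegral_const, hm,
      smul_eq_mul] at h1
    have hi0 := hpos i hi
    have hj0 := hpos j hj
    set I := ∫ z in A i ×ˢ A j, K z.1 z.2 ∂(μ.prod μ)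
    have h2 : c i * c j * I - w i * w j * K (x i) (x j) =
        c i * c j * (I - μ.real (A i) * μ.real (A j) * K (x i) (x j)) := by
      simp only [hc]; field_simp
    have h3 : |c i * c j * (I - μ.real (A i) * μ.real (A j) * K (x i) (x j))| ≤
        ε * (|w i| * |w j|) := by
      rw [abs_mul]
      refine (mul_le_mul_of_nonneg_left h1 (abs_nonneg _)).trans_eq ?_
      simp only [hc, abs_mul, abs_div, abs_of_pos hi0, abs_of_pos hj0]
      field_simp
    linarith [le_abs_self (c i * c j * (I - μ.real (A i) * μ.real (A j) * K (x i) (x j)))]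
  calc kernelEnergy K μ * (∑ i ∈ s, w i) ^ 2
      ≤ ∫ z : X × X, K z.1 z.2 * (g z.1 * g z.2) ∂(μ.prod μ) := by
        have := sq_integral_mul_kernelEnergy_le hK.measurable hM hmin hgm hgB
        rwa [hgint, mul_comm] at this
    _ ≤ ∑ i ∈ s, ∑ j ∈ s, (w i * w j * K (x i) (x j) + ε * (|w i| * |w j|)) := by
        rw [hquad]
        exact Finset.sum_le_sum fun i hi ↦ Finset.sum_le_sum fun j hj ↦ hest i hi j hj
    _ = _ := by simp only [Finset.sum_add_distrib, Finset.mul_sum]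

/-! ### Great circles in the tangent parametrization. -/

section Sphere

variable {E : Type*} [NormedAddCommGroup E] [InnerProductSpace ℝ E]

theorem norm_add_smul_of_orthogonal {z e : E} (hz : ‖z‖ = 1) (he : ‖e‖ = 1) (hze : inner ℝ z e = 0)
    (s : ℝ) : ‖z + s • e‖ = √(1 + s ^ 2) := by
  rw [← Real.sqrt_sq (norm_nonneg (z + s • e)), norm_add_sq_real, inner_smul_right, hze, norm_smul,
    hz, he]
  simp

/-- The normalization of `z + s • e`. -/
noncomputable def sphereCurve {z e : E} (hz : ‖z‖ = 1) (he : ‖e‖ = 1) (hze : inner ℝ z e = 0)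
    (s : ℝ) : Metric.sphere (0 : E) 1 :=
  ⟨(√(1 + s ^ 2))⁻¹ • (z + s • e), by
    have : 0 < √(1 + s ^ 2) := by positivity
    rw [mem_sphere_zero_iff_norm, norm_smul, norm_add_smul_of_orthogonal hz he hze, norm_inv,
      Real.norm_eq_abs, abs_of_pos this, inv_mul_cancel₀ this.ne']⟩

variable {z e : E} (hz : ‖z‖ = 1) (he : ‖e‖ = 1) (hze : inner ℝ z e = 0)

theorem continuous_sphereCurve : Continuous (sphereCurve hz he hze) := by
  unfold sphereCurve
  refine Continuous.subtype_mk (Continuous.smul (Continuous.inv₀ (by fun_prop) fun s ↦ ?_)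
    (by fun_prop)) _
  positivity

theorem sphereCurve_zero : (sphereCurve hz he hze 0 : E) = z := by
  simp [sphereCurve]

theorem inner_sphereCurve (s t : ℝ) :
    inner ℝ (sphereCurve hz he hze s : E) (sphereCurve hz he hze t) =
      (1 + s * t) / (√(1 + s ^ 2) * √(1 + t ^ 2)) := by
  have hez : inner ℝ e z = 0 := by rw [real_inner_comm, hze]
  simp only [sphereCurve, inner_smul_left, inner_smul_right, inner_add_left, inner_add_right,
    hze, hez, real_inner_self_eq_norm_sq, hz, he]
  simp
  field_simp

theorem abs_inner_sphereCurve_rpow (p : ℝ) {s t : ℝ} (hst : 0 ≤ 1 + s * t) :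
    |inner ℝ (sphereCurve hz he hze s : E) (sphereCurve hz he hze t)| ^ p =
      (1 + s * t) ^ p / ((1 + s ^ 2) ^ (p / 2) * (1 + t ^ 2) ^ (p / 2)) := by
  have hsqrt (a : ℝ) (ha : 0 ≤ a) : √a ^ p = a ^ (p / 2) := by
    rw [Real.sqrt_eq_rpow, ← Real.rpow_mul ha]; congr 1; ring
  rw [inner_sphereCurve, abs_of_nonneg (by positivity), Real.div_rpow hst (by positivity),
    Real.mul_rpow (by positivity) (by positivity), hsqrt _ (by positivity), hsqrt _ (by positivity)]

end Sphere

/-! ### The frame kernel and restriction to a great circle. -/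

section FrameKernel

variable {d : ℕ} {p : ℝ}

/-- The kernel `|⟨x, y⟩| ^ p` on the unit sphere. -/
noncomputable def frameKernel (p : ℝ) (x y : UnitSphere d) : ℝ :=
  |inner ℝ (x : EuclideanSpace ℝ (Fin d)) (y : EuclideanSpace ℝ (Fin d))| ^ p

theorem pFrameEnergy_eq_kernelEnergy (μ : ProbabilityMeasure (UnitSphere d)) :
    pFrameEnergy p μ = kernelEnergy (frameKernel p) (μ : Measure (UnitSphere d)) := rfl

theorem frameKernel_nonneg (x y : UnitSphere d) : 0 ≤ frameKernel p x y :=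
  Real.rpow_nonneg (abs_nonneg _) _

theorem continuous_frameKernel (hp : 0 ≤ p) :
    Continuous (Function.uncurry (frameKernel (d := d) p)) := by
  unfold frameKernel Function.uncurry
  exact Continuous.rpow_const (by fun_prop) fun _ ↦ Or.inr hp

theorem abs_frameKernel_le_one (hp : 0 ≤ p) (x y : UnitSphere d) : |frameKernel p x y| ≤ 1 := by
  rw [abs_of_nonneg (frameKernel_nonneg x y)]
  refine Real.rpow_le_one (abs_nonneg _) ?_ hp
  have := abs_real_inner_le_norm (x : EuclideanSpace ℝ (Fin d)) (y : EuclideanSpace ℝ (Fin d))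
  simpa using this

theorem frameKernel_self (x : UnitSphere d) : frameKernel p x x = 1 := by
  simp [frameKernel]

/-- The kernel equals 1 on the diagonal, so it is nonzero on a product neighborhood of `(x, x)`,
which has positive mass when `x` is in the support. -/
theorem kernelEnergy_frameKernel_pos (hp : 0 ≤ p) (μ : Measure (UnitSphere d))
    [IsProbabilityMeasure μ] : 0 < kernelEnergy (frameKernel p) μ := by
  have hi : Integrable (fun z : UnitSphere d × UnitSphere d ↦ frameKernel p z.1 z.2)
      (μ.prod μ) := by
    simpa using integrable_kernel_mul (μ := μ) (continuous_frameKernel hp).measurable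
      (abs_frameKernel_le_one hp) (measurable_const (a := (1 : ℝ))) (B := 1) (by simp)
  have heq : kernelEnergy (frameKernel p) μ = ∫ z, frameKernel p z.1 z.2 ∂(μ.prod μ) :=
    (integral_prod_symm _ hi).symm
  rw [heq, integral_pos_iff_support_of_nonneg (fun z ↦ frameKernel_nonneg _ _) hi]
  obtain ⟨x, hx⟩ := Measure.nonempty_support (IsProbabilityMeasure.ne_zero μ)
  have hnhds : Function.support (fun z : UnitSphere d × UnitSphere d ↦ frameKernel p z.1 z.2) ∈
      𝓝 (x, x) :=
    (continuous_frameKernel hp).continuousAt.eventually_ne (y := 0)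
      (by simp [Function.uncurry, frameKernel_self])
  obtain ⟨U, hU, V, hV, hUV⟩ := mem_nhds_prod_iff.1 hnhds
  refine lt_of_lt_of_le ?_ (measure_mono hUV)
  rw [Measure.prod_prod]
  exact ENNReal.mul_pos ((Measure.mem_support_iff_forall x).1 hx U hU).ne'
    ((Measure.mem_support_iff_forall x).1 hx V hV).ne'

theorem exists_norm_eq_one_inner_eq_zero (hd : 2 ≤ d) (z : EuclideanSpace ℝ (Fin d)) :
    ∃ e : EuclideanSpace ℝ (Fin d), ‖e‖ = 1 ∧ inner ℝ z e = 0 := by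
  obtain ⟨v, hv, hv0⟩ : ∃ v ∈ (ℝ ∙ z)ᗮ, v ≠ 0 := by
    refine Submodule.exists_mem_ne_zero_of_ne_bot fun h ↦ ?_
    rw [Submodule.orthogonal_eq_bot_iff] at h
    have h1 := finrank_span_le_card (R := ℝ) ({z} : Set (EuclideanSpace ℝ (Fin d)))
    rw [h, finrank_top, finrank_euclideanSpace_fin, Set.toFinset_singleton,
      Finset.card_singleton] at h1
    omega
  refine ⟨‖v‖⁻¹ • v, norm_smul_inv_norm (𝕜 := ℝ) hv0, ?_⟩
  rw [inner_smul_right, Submodule.mem_orthogonal_singleton_iff_inner_right.1 hv, mul_zero]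

/-- If the support of a minimizer contains a neighborhood of a point, then testing positivity along
a great circle through that point yields a one-dimensional positivity statement. -/
theorem dominatesRankOne_of_mem_interior_support (hd : 2 ≤ d) (hp : 0 < p)
    {μ : ProbabilityMeasure (UnitSphere d)} (hμ : IsPFrameMinimizer p μ) {z : UnitSphere d}
    (hz : z ∈ interior (μ : Measure (UnitSphere d)).support) :
    DominatesRankOne p (pFrameEnergy p μ) := by
  obtain ⟨e, he, hze⟩ := exists_norm_eq_one_inner_eq_zero hd (z : EuclideanSpace ℝ (Fin d))
  have hz1 : ‖(z : EuclideanSpace ℝ (Fin d))‖ = 1 := norm_eq_of_mem_sphere z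
  set γ : ℝ → UnitSphere d := sphereCurve hz1 he hze
  have hγ0 : γ 0 = z := Subtype.ext (sphereCurve_zero hz1 he hze)
  have hnear : ∀ᶠ s in 𝓝 (0 : ℝ), γ s ∈ (μ : Measure (UnitSphere d)).support := by
    refine (continuous_sphereCurve hz1 he hze).continuousAt.eventually_mem ?_
    change _ ∈ 𝓝 (γ 0)
    rw [hγ0]
    exact mem_interior_iff_mem_nhds.1 hz
  obtain ⟨δ, hδ, hball⟩ := Metric.eventually_nhds_iff.1 hnear
  -- `δ` keeps the arc inside the support; `1` ensures `1 + s i * s j ≥ 0`, so the absolute value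
  -- disappears.
  refine ⟨min δ 1, by positivity, fun n w s hs ↦ ?_⟩
  have hmin (ν : Measure (UnitSphere d)) (hν : IsProbabilityMeasure ν) :
      kernelEnergy (frameKernel p) (μ : Measure (UnitSphere d)) ≤
        kernelEnergy (frameKernel p) ν := hμ ⟨ν, hν⟩
  -- The factors `(1 + s i ^ 2) ^ (p / 2)` in the weights cancel the denominators coming from
  -- normalization.
  have h := kernelEnergy_mul_sq_sum_le (continuous_frameKernel hp.le)
    (abs_frameKernel_le_one hp.le) hmin (Finset.range n)
    (fun i ↦ w i * (1 + s i ^ 2) ^ (p / 2)) (fun i ↦ γ (s i))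
    fun i hi ↦ hball (by simpa using (hs i hi).trans_le (min_le_left _ _))
  rw [← pFrameEnergy_eq_kernelEnergy] at h
  refine h.trans_eq (Finset.sum_congr rfl fun i hi ↦ Finset.sum_congr rfl fun j hj ↦ ?_)
  have hi1 : |s i| ≤ 1 := ((hs i hi).trans_le (min_le_right _ _)).le
  have hj1 : |s j| ≤ 1 := ((hs j hj).trans_le (min_le_right _ _)).le
  have hst : 0 ≤ 1 + s i * s j := by
    have : |s i * s j| ≤ 1 := by
      rw [abs_mul]
      exact mul_le_one₀ hi1 (abs_nonneg _) hj1
    linarith [(abs_le.1 this).1]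
  have hk : frameKernel p (γ (s i)) (γ (s j)) = _ :=
    abs_inner_sphereCurve_rpow hz1 he hze p hst
  have h1 : 0 < (1 + s i ^ 2) ^ (p / 2) := by positivity
  have h2 : 0 < (1 + s j ^ 2) ^ (p / 2) := by positivity
  rw [hk]
  field_simp

end FrameKernel

theorem theorem1p3 (d : ℕ) (hd : 2 ≤ d) (p : ℝ) (hp : 0 < p) (hp_even : ∀ k : ℕ, p ≠ 2 * (k : ℝ))
    (μ : ProbabilityMeasure (UnitSphere d)) (hμ : IsPFrameMinimizer p μ) :
    interior (μ : Measure (UnitSphere d)).support = ∅ := by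
  refine Set.eq_empty_of_forall_notMem fun z hz ↦ ?_
  exact (dominatesRankOne_of_mem_interior_support hd hp hμ hz).false_of_not_even hp hp_even
    (kernelEnergy_frameKernel_pos hp.le _)
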